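/- Let $B=\bigoplus_{n\ge 0}B_n$ be a commutative graded $\mathbb C$-algebra. Call $B$ *approximable* if it is an integral domain and 1. every $B_n$ is finite dimensional over $\mathbb C$; 2. $B_n\neq 0$ for all sufficiently large $n$; 3. for every $\varepsilon>0$ there is a $p_0$ such that for all $p\ge p_0$ $$\liminf_{n\to\infty}\frac{\dim \operatorname{Im}(\operatorname{Sym}^nB_p\to B_{np})}{\dim B_{np}}>1-\varepsilon .$$ A complex variety is an integral separated scheme of finite type over $\mathbb C$. A line bundle $L$ on a complex variety $X$ of dimension $d$ is *big* if $\operatorname{vol}(L)=\limsup_{n\to\infty} d!\,h^0(X,L^{\otimes n})/n^d>0$ (if $X$ is not complete, $h^0=\infty$ is allowed). Call $B$ *non-sectional* if there are no complex variety $X$ and big line bundle $L$ on $X$ such that $B$ is isomorphic, as a graded $\mathbb C$-algebra, to a graded subalgebra of the section ring $\bigoplus_{n\ge 0}H^0(X,L^{\otimes n})$. **Theorem.** There exists an approximable graded $\mathbb C$-algebra which is non-sectional. More precisely, let $z_0,z_1,z_2,\dots$ be any sequence of pairwise distinct complex numbers, and for $n\ge 0$ put $$J(n)=\sum_{i\ge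 0}\lfloor n/2^i\rfloor,\qquad P_n(x)=\prod_{i\ge 0}(x-z_i)^{\lfloor n/2^i\rfloor},\qquad B_n=\Big\{\tfrac{Q(x)}{P_n(x)} : Q\in\mathbb C[x],\ \deg Q\le J(n)\Big\}\subset\mathbb C(x).$$ Then, with the products $B_m\times B_n\to B_{m+n}$ given by the multiplication of $\mathbb C(x)$, the graded algebra $B=\bigoplus_{n\ge 0} B_n$ (external direct sum) is approximable and non-sectional. -/

import Mathlib

open CategoryTheory AlgebraicGeometry DirectSum
open scoped Polynomial ENNReal Nat

noncomputable section

/-! ### Approximable graded algebras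

A graded `ℂ`-algebra `B = ⨁ n, B_n` is given by its graded pieces: a family `B : ℕ → Type` of
complex vector spaces with `DirectSum.GCommRing B` and `DirectSum.GAlgebra ℂ B`. -/

/-- The image of `Sym^n B_p → B_{np}`: the linear span, inside `B = ⨁ n, B_n`, of all products
of `n` elements of `B_p`. -/
def symImage (B : ℕ → Type) [∀ n, AddCommGroup (B n)] [∀ n, Module ℂ (B n)]
    [DirectSum.GCommRing B] [DirectSum.GAlgebra ℂ B] (n p : ℕ) : Submodule ℂ (⨁ k, B k) :=
  (LinearMap.range (DirectSum.lof ℂ ℕ B p)) ^ n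

/-- Approximable integral graded algebras. -/
structure IsApproximable (B : ℕ → Type) [∀ n, AddCommGroup (B n)] [∀ n, Module ℂ (B n)]
    [DirectSum.GCommRing B] [DirectSum.GAlgebra ℂ B] : Prop where
  isDomain : IsDomain (⨁ n, B n)
  finiteDimensional : ∀ n, FiniteDimensional ℂ (B n)
  eventually_nontrivial : ∀ᶠ n in Filter.atTop, Nontrivial (B n)
  approx : ∀ ε : ℝ, 0 < ε → ∃ p₀ : ℕ, ∀ p ≥ p₀,
    1 - ε < Filter.liminf (fun n : ℕ =>
      (Module.finrank ℂ (symImage B n p) : ℝ) / (Module.finrank ℂ (B (n * p)) : ℝ)) Filter.atTop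

/-! ### Tensor algebras and semilinear maps -/

section TensorAlgebraMap

variable {R S M N : Type*} [CommRing R] [CommRing S] [AddCommGroup M] [AddCommGroup N]
  [Module R M] [Module S N] {σ : R →+* S}

/-- The ring homomorphism `T_R(M) → T_S(N)`, `m₁ ⊗ ⋯ ⊗ mₙ ↦ f m₁ ⊗ ⋯ ⊗ f mₙ`, induced by a
`σ`-semilinear map `f : M → N`. -/
def tensorAlgebraMap (f : M →ₛₗ[σ] N) : TensorAlgebra R M →+* TensorAlgebra S N :=
  letI : Algebra R (TensorAlgebra S N) :=
    ((algebraMap S (TensorAlgebra S N)).comp σ).toAlgebra' fun r t => Algebra.commutes (σ r) t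
  (TensorAlgebra.lift R
    ({ toFun := fun m => TensorAlgebra.ι S (f m)
       map_add' := fun a b => by simp
       map_smul' := fun r a => by
        rw [f.map_smulₛₗ, map_smul, Algebra.smul_def, Algebra.smul_def]; rfl } :
      M →ₗ[R] TensorAlgebra S N)).toRingHom

theorem tensorAlgebraMap_ι (f : M →ₛₗ[σ] N) (m : M) :
    tensorAlgebraMap f (TensorAlgebra.ι R m) = TensorAlgebra.ι S (f m) := by
  let _ : Algebra R (TensorAlgebra S N) :=
    ((algebraMap S (TensorAlgebra S N)).comp σ).toAlgebra' fun r t => Algebra.commutes (σ r) t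
  exact TensorAlgebra.lift_ι_apply _ _

theorem tensorAlgebraMap_algebraMap (f : M →ₛₗ[σ] N) (r : R) :
    tensorAlgebraMap f (algebraMap R _ r) = algebraMap S _ (σ r) := by
  let _ : Algebra R (TensorAlgebra S N) :=
    ((algebraMap S (TensorAlgebra S N)).comp σ).toAlgebra' fun r t => Algebra.commutes (σ r) t
  exact AlgHom.commutes _ _

variable (R M) in
/-- The `n`-th tensor power `T^n_R(M)`, as a submodule of the tensor algebra. -/
def tensorPow (n : ℕ) : Submodule R (TensorAlgebra R M) :=
  (LinearMap.range (TensorAlgebra.ι R : M →ₗ[R] TensorAlgebra R M)) ^ n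

theorem tensorAlgebraMap_mem (f : M →ₛₗ[σ] N) (n : ℕ) {p : TensorAlgebra R M}
    (hp : p ∈ tensorPow R M n) : tensorAlgebraMap f p ∈ tensorPow S N n := by
  unfold tensorPow at *
  induction hp using Submodule.pow_induction_on_left' with
  | algebraMap r =>
    rw [tensorAlgebraMap_algebraMap, pow_zero]
    exact Submodule.algebraMap_mem _
  | add x y i _ _ hx hy => rw [map_add]; exact add_mem hx hy
  | mem_mul m hm i x _ hx =>
    obtain ⟨m, rfl⟩ := hm
    rw [map_mul, tensorAlgebraMap_ι, pow_succ']
    exact Submodule.mul_mem_mul ⟨_, rfl⟩ hx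

end TensorAlgebraMap

/-! ### Sections of tensor powers of a sheaf of modules -/

section Sections

variable {X : Scheme.{0}} (L : X.Modules)

/-- The stalk `L_x` is a module over the local ring of `X` at `x`. -/
instance stalkModule (x : X) : Module (X.presheaf.stalk x) (L.presheaf.stalk x) :=
  PresheafOfModules.instModuleCarrierStalkCommRingCatCarrierAbPresheafOpensCarrier
    (R := X.presheaf) L.val x

/-- The map `L(U) → L_x` taking a section to its germ. -/
def germMap (U : X.Opens) (x : X) (hx : x ∈ U) :
    Γ(L, U) →ₛₗ[(X.presheaf.germ U x hx).hom] L.presheaf.stalk x where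
  toFun := L.presheaf.germ U x hx
  map_add' := map_add _
  map_smul' r m := PresheafOfModules.germ_smul (R := X.presheaf) L.val x U hx r m

/-- The restriction map `L(U) → L(V)`. -/
def resMap {U V : X.Opens} (h : V ≤ U) :
    Γ(L, U) →ₛₗ[(X.presheaf.map (homOfLE h).op).hom] Γ(L, V) where
  toFun := L.presheaf.map (homOfLE h).op
  map_add' := map_add _
  map_smul' r m := L.map_smul (homOfLE h) r m

/-- `L` is a line bundle: locally it has a section `e` such that `r ↦ r • e` is an isomorphism
from the structure sheaf to `L`. -/
def IsLineBundle : Prop :=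
  ∀ x : X, ∃ U : X.Opens, x ∈ U ∧ ∃ e : Γ(L, U), ∀ (V : X.Opens) (h : V ≤ U),
    Function.Bijective fun r : Γ(X, V) => r • resMap L h e

/-- The germ at `x` of an element of the tensor algebra of `L(U)`. -/
def tensorGerm (U : X.Opens) (x : X) (hx : x ∈ U) :
    TensorAlgebra Γ(X, U) Γ(L, U) →+* TensorAlgebra (X.presheaf.stalk x) (L.presheaf.stalk x) :=
  tensorAlgebraMap (germMap L U x hx)

theorem tensorGerm_res {U V : X.Opens} (h : V ≤ U) (x : X) (hx : x ∈ V)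
    (p : TensorAlgebra Γ(X, U) Γ(L, U)) :
    tensorGerm L V x hx (tensorAlgebraMap (resMap L h) p) = tensorGerm L U x (h hx) p := by
  unfold tensorGerm
  induction p using TensorAlgebra.induction with
  | algebraMap r =>
    simp only [tensorAlgebraMap_algebraMap]
    congr 1
    exact TopCat.Presheaf.germ_res_apply X.presheaf (homOfLE h) x hx r
  | ι m =>
    simp only [tensorAlgebraMap_ι]
    congr 1
    exact TopCat.Presheaf.germ_res_apply L.presheaf (homOfLE h) x hx m
  | mul a b ha hb => simp only [map_mul, ha, hb]
  | add a b ha hb => simp only [map_add, ha, hb]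

/-- Families `(s_x)_{x ∈ X}` with `s_x` in the tensor algebra of the stalk `L_x`. -/
def TensorGerms : Type :=
  ∀ x : X, TensorAlgebra (X.presheaf.stalk x) (L.presheaf.stalk x)

instance tensorGermsRing : Ring (TensorGerms L) :=
  inferInstanceAs (Ring (∀ x : X, TensorAlgebra (X.presheaf.stalk x) (L.presheaf.stalk x)))

variable [X.Over (Spec (.of ℂ))]

variable (X) in
/-- The constants: the ring homomorphism `ℂ → Γ(X, 𝒪)` given by the structure morphism. -/
def constMap : ℂ →+* Γ(X, ⊤) :=
  ((Scheme.ΓSpecIso (.of ℂ)).inv ≫ (X ↘ Spec (.of ℂ)).appTop).hom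

instance tensorGermsAlgebra : Algebra ℂ (TensorGerms L) :=
  (RingHom.pi fun x : X => ((algebraMap (X.presheaf.stalk x)
      (TensorAlgebra (X.presheaf.stalk x) (L.presheaf.stalk x))).comp
        (X.presheaf.germ ⊤ x trivial).hom).comp (constMap X) :
    ℂ →+* TensorGerms L).toAlgebra' fun c s => funext fun x =>
      Algebra.commutes (A := TensorAlgebra (X.presheaf.stalk x) (L.presheaf.stalk x))
        ((X.presheaf.germ ⊤ x trivial).hom (constMap X c)) (s x)

/-- `H⁰(X, L^{⊗ n})`: the global sections of the sheaf associated with the presheaf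
`U ↦ L(U) ⊗ ⋯ ⊗ L(U)` (`n` factors, over `𝒪(U)`), i.e. the families of germs which are locally
induced by elements of `L(U)^{⊗ n}`. -/
def tensorPowSections (n : ℕ) : Submodule ℂ (TensorGerms L) where
  carrier := {s | ∀ x : X, ∃ U : X.Opens, x ∈ U ∧ ∃ p ∈ tensorPow Γ(X, U) Γ(L, U) n,
    ∀ (y : X) (hy : y ∈ U), s y = tensorGerm L U y hy p}
  zero_mem' x := ⟨⊤, trivial, 0, zero_mem _, fun y hy => (map_zero _).symm⟩
  add_mem' {s t} hs ht x := by
    obtain ⟨U, hxU, p, hp, hs⟩ := hs x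
    obtain ⟨V, hxV, q, hq, ht⟩ := ht x
    refine ⟨U ⊓ V, ⟨hxU, hxV⟩,
      tensorAlgebraMap (resMap L inf_le_left) p + tensorAlgebraMap (resMap L inf_le_right) q,
      add_mem (tensorAlgebraMap_mem _ _ hp) (tensorAlgebraMap_mem _ _ hq), fun y hy => ?_⟩
    rw [map_add, tensorGerm_res, tensorGerm_res, ← hs y hy.1, ← ht y hy.2]
    rfl
  smul_mem' c s hs x := by
    obtain ⟨U, hxU, p, hp, hs⟩ := hs x
    refine ⟨U, hxU, X.presheaf.map (homOfLE le_top).op (constMap X c) • p,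
      Submodule.smul_mem _ _ hp, fun y hy => ?_⟩
    have hc : (algebraMap ℂ (TensorGerms L) c) y = tensorGerm L U y hy (algebraMap Γ(X, U)
        (TensorAlgebra Γ(X, U) Γ(L, U))
        (X.presheaf.map (homOfLE le_top).op (constMap X c))) := by
      unfold tensorGerm
      rw [tensorAlgebraMap_algebraMap]
      exact congrArg (algebraMap (X.presheaf.stalk y)
        (TensorAlgebra (X.presheaf.stalk y) (L.presheaf.stalk y)))
        (TopCat.Presheaf.germ_res_apply X.presheaf (homOfLE le_top) y hy (constMap X c)).symm
    rw [Algebra.smul_def, Algebra.smul_def, map_mul, ← hs y hy, ← hc]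
    rfl

/-- The multiplication `H⁰(X, L^{⊗ m}) × H⁰(X, L^{⊗ n}) → H⁰(X, L^{⊗ (m + n)})` is the tensor
product of sections. It makes `⨁ n, tensorPowSections L n` the section ring of `L`. -/
instance tensorPowSections_gradedMonoid : SetLike.GradedMonoid (tensorPowSections L) where
  one_mem x := ⟨⊤, trivial, 1, by
    unfold tensorPow; rw [pow_zero]; exact Submodule.one_le.mp le_rfl,
    fun y hy => (map_one _).symm⟩
  mul_mem {m n s t} hs ht x := by
    obtain ⟨U, hxU, p, hp, hs⟩ := hs x
    obtain ⟨V, hxV, q, hq, ht⟩ := ht x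
    refine ⟨U ⊓ V, ⟨hxU, hxV⟩,
      tensorAlgebraMap (resMap L inf_le_left) p * tensorAlgebraMap (resMap L inf_le_right) q,
      ?_, fun y hy => ?_⟩
    · unfold tensorPow
      rw [pow_add]
      exact Submodule.mul_mem_mul (tensorAlgebraMap_mem _ _ hp) (tensorAlgebraMap_mem _ _ hq)
    rw [map_mul, tensorGerm_res, tensorGerm_res, ← hs y hy.1, ← ht y hy.2]
    rfl

/-- `h⁰(nL) = dim H⁰(X, L^{⊗ n})`, possibly infinite if `X` is not proper. -/
def hZero (n : ℕ) : ℕ∞ := Cardinal.toENat (Module.rank ℂ (tensorPowSections L n))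

/-- The volume of `L`, where `d` is the dimension of `X`. -/
def lineBundleVolume (d : ℕ) : ℝ≥0∞ :=
  Filter.limsup (fun n : ℕ => (d ! : ℝ≥0∞) * (hZero L n : ℝ≥0∞) / (n : ℝ≥0∞) ^ d) Filter.atTop

/-- `L` is big: its volume is positive. -/
def IsBig : Prop :=
  ∃ d : ℕ, topologicalKrullDim X = d ∧ 0 < lineBundleVolume L d

variable (X) in
/-- Complex varieties: integral separated schemes of finite type over `ℂ`. -/
structure IsComplexVariety : Prop where
  isIntegral : IsIntegral X
  isSeparated : IsSeparated (X ↘ Spec (.of ℂ))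
  locallyOfFiniteType : LocallyOfFiniteType (X ↘ Spec (.of ℂ))
  quasiCompact : QuasiCompact (X ↘ Spec (.of ℂ))

end Sections

/-- `B` is isomorphic to a graded subalgebra of the section ring of `L`, i.e. there is an
injective homomorphism of graded `ℂ`-algebras `⨁ B_n → ⨁ H⁰(X, L^{⊗ n})`. -/
def EmbedsInSectionRing (B : ℕ → Type) [∀ n, AddCommGroup (B n)] [∀ n, Module ℂ (B n)]
    [DirectSum.GCommRing B] [DirectSum.GAlgebra ℂ B]
    {X : Scheme.{0}} [X.Over (Spec (.of ℂ))] (L : X.Modules) : Prop :=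
  ∃ f : (⨁ n, B n) →ₐ[ℂ] (⨁ n, tensorPowSections L n), Function.Injective f ∧
    ∀ (n : ℕ) (b : B n), ∃ s : tensorPowSections L n,
      f (DirectSum.of B n b) = DirectSum.of (fun k => tensorPowSections L k) n s

/-- `B` is non-sectional: it is not isomorphic to a graded subalgebra of the section ring of a
big line bundle on a complex variety. -/
def IsNonSectional (B : ℕ → Type) [∀ n, AddCommGroup (B n)] [∀ n, Module ℂ (B n)]
    [DirectSum.GCommRing B] [DirectSum.GAlgebra ℂ B] : Prop :=
  ∀ (X : Scheme.{0}) [X.Over (Spec (.of ℂ))], IsComplexVariety X →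
    ∀ L : X.Modules, IsLineBundle L → IsBig L → ¬ EmbedsInSectionRing B L

/-! ### The example -/

/-- `J(n) = ∑ᵢ ⌊n / 2^i⌋`; the terms with `i > n` vanish. -/
def exampleJ (n : ℕ) : ℕ := ∑ i ∈ Finset.range (n + 1), n / 2 ^ i

/-- `P_n = ∏ᵢ (x - zᵢ)^⌊n / 2^i⌋`; the factors with `i > n` are `1`. -/
def exampleP (z : ℕ → ℂ) (n : ℕ) : ℂ[X] :=
  ∏ i ∈ Finset.range (n + 1), (Polynomial.X - Polynomial.C (z i)) ^ (n / 2 ^ i)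

theorem exampleP_eq (z : ℕ → ℂ) {n N : ℕ} (h : n ≤ N) :
    exampleP z n =
      ∏ i ∈ Finset.range (N + 1), (Polynomial.X - Polynomial.C (z i)) ^ (n / 2 ^ i) := by
  refine Finset.prod_subset (Finset.range_subset_range.2 (by omega)) fun i _ hi => ?_
  have h1 : n < i := by simpa using hi
  rw [Nat.div_eq_of_lt (h1.trans Nat.lt_two_pow_self), pow_zero]

theorem exampleP_monic (z : ℕ → ℂ) (n : ℕ) : (exampleP z n).Monic :=
  Polynomial.monic_prod_of_monic _ _ fun i _ => (Polynomial.monic_X_sub_C (z i)).pow _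

theorem exampleP_natDegree (z : ℕ → ℂ) (n : ℕ) : (exampleP z n).natDegree = exampleJ n := by
  unfold exampleP exampleJ
  rw [Polynomial.natDegree_prod_of_monic _ _ fun i _ => (Polynomial.monic_X_sub_C (z i)).pow _]
  refine Finset.sum_congr rfl fun i _ => ?_
  rw [Polynomial.natDegree_pow, Polynomial.natDegree_X_sub_C, mul_one]

theorem exampleP_mul_dvd (z : ℕ → ℂ) (m n : ℕ) :
    exampleP z m * exampleP z n ∣ exampleP z (m + n) := by
  rw [exampleP_eq z (Nat.le_add_right m n), exampleP_eq z (Nat.le_add_left n m), exampleP,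
    ← Finset.prod_mul_distrib]
  refine Finset.prod_dvd_prod_of_dvd _ _ fun i _ => ?_
  rw [← pow_add]
  exact pow_dvd_pow _ (Nat.div_add_div_le_add_div)

/-- `B_n = {Q / P_n : deg Q ≤ J(n)} ⊆ ℂ(x)`. -/
def exampleB (z : ℕ → ℂ) (n : ℕ) : Submodule ℂ (RatFunc ℂ) where
  carrier := {f | ∃ Q : ℂ[X], Q.natDegree ≤ exampleJ n ∧
    f = algebraMap ℂ[X] (RatFunc ℂ) Q / algebraMap ℂ[X] (RatFunc ℂ) (exampleP z n)}
  zero_mem' := ⟨0, by simp, by simp⟩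
  add_mem' := by
    rintro _ _ ⟨Q, hQ, rfl⟩ ⟨Q', hQ', rfl⟩
    exact ⟨Q + Q', Polynomial.natDegree_add_le_of_degree_le hQ hQ', by rw [map_add, add_div]⟩
  smul_mem' := by
    rintro c _ ⟨Q, hQ, rfl⟩
    refine ⟨c • Q, (Polynomial.natDegree_smul_le c Q).trans hQ, ?_⟩
    rw [Algebra.smul_def, Algebra.smul_def, map_mul, mul_div_assoc,
      ← IsScalarTower.algebraMap_apply]

/-- The product `B_m × B_n → B_{m+n}` is the multiplication of `ℂ(x)`. It makes
`⨁ n, exampleB z n` a graded algebra. -/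
instance exampleB_gradedMonoid (z : ℕ → ℂ) : SetLike.GradedMonoid (exampleB z) where
  one_mem := ⟨1, by simp, by simp [exampleP]⟩
  mul_mem := by
    rintro m n _ _ ⟨Q, hQ, rfl⟩ ⟨Q', hQ', rfl⟩
    obtain ⟨D, hD⟩ := exampleP_mul_dvd z m n
    have h0 : ∀ k, exampleP z k ≠ 0 := fun k => (exampleP_monic z k).ne_zero
    have hD0 : D ≠ 0 := by
      rintro rfl
      exact h0 _ (hD.trans (mul_zero _))
    have hdeg : exampleJ (m + n) = exampleJ m + exampleJ n + D.natDegree := by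
      rw [← exampleP_natDegree z, hD, Polynomial.natDegree_mul (mul_ne_zero (h0 m) (h0 n)) hD0,
        Polynomial.natDegree_mul (h0 m) (h0 n), exampleP_natDegree, exampleP_natDegree]
    refine ⟨Q * Q' * D, ?_, ?_⟩
    · have h1 := Polynomial.natDegree_mul_le (p := Q * Q') (q := D)
      have h2 := Polynomial.natDegree_mul_le (p := Q) (q := Q')
      omega
    · have h1 : algebraMap ℂ[X] (RatFunc ℂ) D ≠ 0 := by simpa using hD0
      rw [hD, map_mul, map_mul, map_mul, map_mul, mul_div_mul_right _ _ h1, div_mul_div_comm]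

end

/-! Approximability is a dimension count. `B_n` has dimension `J(n) + 1`, and `J(n) < 2n` for `n >
0`, while the products of `n` elements of `B_p` span every `Q / P_p ^ n` with `deg Q ≤ n J(p)`. The
quotient of dimensions is therefore at least `J(p) / (2p)`, which tends to `1`
(`le_finrank_symImage`, `exampleJ_lt`, `tendsto_exampleJ_div`).

For non-sectionality, let `s = 1` and `t = 1 / (x - z₀)`, both in degree one. Then `s + (z₀ - zᵢ) t
= (x - zᵢ) / (x - z₀)`, and its inverse lies in `B_{2^i}`. So `s + (z₀ - zᵢ) t` divides `s ^ (2 ^ i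
+ 1)` in `B` for every `i`, that is, for infinitely many scalars (`of_mul_add_smul_eq_pow`).

Sections of a line bundle on a variety cannot behave in this way. If `s + c t` divides a power of
`s`, then it vanishes only where `s` does, so on an affine trivializing open set the function `t /
s` omits the value `-1/c` where `s ≠ 0`. But `t / s` is not constant, hence transcendental over `ℂ`,
and by openness of flat maps of finite presentation it omits only finitely many values
(`Transcendental.finite_isUnit_sub_algebraMap`, `IsLineBundle.finite_mul_add_smul_eq_pow`). -/

/-! ### Invertible translates of a transcendental element -/

section FiniteTypeAlgebras

variable {k A : Type*} [Field k] [CommRing A] [IsDomain A] [Algebra k A] [Algebra.FiniteType k A]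

/-- If `y` is a transcendental element of a finitely generated domain over a field `k`, then
`y - c` is a unit for only finitely many `c : k`. -/
theorem Transcendental.finite_isUnit_sub_algebraMap {y : A} (hy : Transcendental k y) :
    {c : k | IsUnit (y - algebraMap k A c)}.Finite := by
  let Φ : k[X] →ₐ[k] A := Polynomial.aeval y
  algebraize [Φ.toRingHom]
  have hΦ : Function.Injective (algebraMap k[X] A) := transcendental_iff_injective.1 hy
  have : IsScalarTower k k[X] A := IsScalarTower.of_algHom Φ
  have : Algebra.FiniteType k[X] A := Algebra.FiniteType.of_restrictScalars_finiteType k k[X] A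
  have : Algebra.FinitePresentation k[X] A := Algebra.FinitePresentation.of_finiteType.1 this
  have : FaithfulSMul k[X] A := (faithfulSMul_iff_algebraMap_injective _ _).2 hΦ
  -- Torsion-free over a principal ideal domain implies flat, so `Spec A → Spec k[X]` is open.
  have : Module.IsTorsionFree k[X] A := inferInstance
  have : Module.Flat k[X] A := inferInstance
  have hopen := PrimeSpectrum.isOpenMap_comap_of_hasGoingDown_of_finitePresentation
    (R := k[X]) (S := A)
  have hrange : IsOpen (Set.range (PrimeSpectrum.comap (algebraMap k[X] A))) :=
    hopen.isOpen_range
  have hne : (Set.range (PrimeSpectrum.comap (algebraMap k[X] A))).Nonempty :=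
    Set.range_nonempty _
  obtain ⟨q, hq⟩ := hne
  obtain ⟨_, ⟨g, rfl⟩, hqg, hg⟩ :=
    PrimeSpectrum.isTopologicalBasis_basic_opens.exists_subset_of_mem_open hq hrange
  have hg0 : g ≠ 0 := by
    rintro rfl
    simp at hqg
  refine (Polynomial.rootSet_finite g k).subset fun c hc => ?_
  rw [Polynomial.mem_rootSet]
  refine ⟨hg0, ?_⟩
  -- If `g(c) ≠ 0`, the prime `(X - c)` lies in `D(g)`, hence is the contraction of a prime `r` of
  -- `A`; then `r` contains the unit `y - c`.
  by_contra hgc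
  have hprime : (Ideal.span {(Polynomial.X - Polynomial.C c : k[X])}).IsPrime :=
    (Ideal.span_singleton_prime (Polynomial.X_sub_C_ne_zero c)).2 (Polynomial.prime_X_sub_C c)
  obtain ⟨r, hr⟩ := hg (show (⟨_, hprime⟩ : PrimeSpectrum k[X]) ∈ _ by
    change g ∉ Ideal.span _
    rw [Ideal.mem_span_singleton, Polynomial.dvd_iff_isRoot]
    simpa [Polynomial.IsRoot] using hgc)
  have hmem : Polynomial.X - Polynomial.C c ∈
      (PrimeSpectrum.comap (algebraMap k[X] A) r).asIdeal := by
    rw [hr]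
    exact Ideal.mem_span_singleton_self _
  refine r.2.ne_top (Ideal.eq_top_of_isUnit_mem _ ?_ hc)
  have : algebraMap k[X] A (Polynomial.X - Polynomial.C c) = y - algebraMap k A c := by
    change Polynomial.aeval y _ = _
    simp
  rw [← this]
  exact hmem

/-- In a finitely generated domain over an algebraically closed field, if `b` is not a scalar
multiple of `a ≠ 0`, then for all but finitely many scalars `c` the locus `a + c b = 0` contains a
point at which `a` does not vanish. -/
theorem finite_forall_add_smul_mem_imp_mem [IsAlgClosed k] {a b : A} (ha : a ≠ 0)
    (hb : ∀ c : k, b ≠ c • a) :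
    {c : k | ∀ q : PrimeSpectrum A, a + c • b ∈ q.asIdeal → a ∈ q.asIdeal}.Finite := by
  let S := Localization.Away a
  have hle : Submonoid.powers a ≤ nonZeroDivisors A :=
    powers_le_nonZeroDivisors_of_noZeroDivisors ha
  have : IsDomain S := IsLocalization.isDomain_localization hle
  have : Algebra.FiniteType A S := IsLocalization.finiteType_of_monoid_fg (Submonoid.powers a) S
  have : Algebra.FiniteType k S := Algebra.FiniteType.trans (S := A) inferInstance inferInstance
  have hinj : Function.Injective (algebraMap A S) := IsLocalization.injective S hle
  let y : S := algebraMap A S b * IsLocalization.Away.invSelf a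
  have hinv : algebraMap A S a * IsLocalization.Away.invSelf a = 1 :=
    IsLocalization.Away.mul_invSelf a
  have hya : y * algebraMap A S a = algebraMap A S b := by
    rw [mul_assoc, mul_comm _ (algebraMap A S a), hinv, mul_one]
  -- If `y = b / a` were algebraic, its minimal polynomial would be linear, so `y` would be a
  -- scalar.
  have hy : Transcendental k y := fun hy => by
    obtain ⟨c, hc⟩ := minpoly.mem_range_of_degree_eq_one k y
      (IsAlgClosed.degree_eq_one_of_irreducible k
        (minpoly.irreducible (isAlgebraic_iff_isIntegral.1 hy)))
    refine hb c (hinj ?_)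
    rw [← hya, ← hc, Algebra.smul_def, map_mul, ← IsScalarTower.algebraMap_apply]
  -- For `c ≠ 0`, `a + c b = c a (y + c⁻¹)` in `A[1/a]`, so the exceptional `c` are those with `y -
  -- (-c⁻¹)` a unit. The value `c = 0` always satisfies the condition and is added by hand.
  have hfin := (hy.finite_isUnit_sub_algebraMap.preimage
    (f := fun c : k => -c⁻¹) (fun x _ y _ h => by simpa using h)).union (Set.finite_singleton 0)
  refine hfin.subset fun c hc => ?_
  by_cases hc0 : c = 0
  · exact Or.inr hc0
  refine Or.inl ?_
  by_contra hunit
  -- A maximal ideal of `A[1/a]` containing `y + c⁻¹` contracts to a prime of `A` containing `a + c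
  -- b`, hence containing `a`, which is invertible in `A[1/a]`.
  obtain ⟨m, hm, hmem⟩ := exists_max_ideal_of_mem_nonunits hunit
  have hmp := hm.isPrime
  have h1 := hc (PrimeSpectrum.comap (algebraMap A S) ⟨m, hmp⟩) (by
    change algebraMap A S (a + c • b) ∈ m
    have : algebraMap A S (a + c • b)
        = (algebraMap k S c * algebraMap A S a) * (y - algebraMap k S (-c⁻¹)) := by
      have hcc : algebraMap k S c * algebraMap k S c⁻¹ = 1 := by
        rw [← map_mul, mul_inv_cancel₀ hc0, map_one]
      rw [map_add, Algebra.smul_def, map_mul, ← IsScalarTower.algebraMap_apply, map_neg, ← hya]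
      linear_combination (-algebraMap A S a) * hcc
    rw [this]
    exact Ideal.mul_mem_left _ _ hmem)
  exact hm.ne_top (Ideal.eq_top_of_isUnit_mem _ h1 (.of_mul_eq_one _ hinv))

end FiniteTypeAlgebras

/-! ### Local trivializations of line bundles -/

noncomputable section Trivializations

variable {X : Scheme.{0}} (L : X.Modules)

/-- The section `e` of `L` over `U` trivializes `L` on `U`. -/
def IsTrivialization (U : X.Opens) (e : Γ(L, U)) : Prop :=
  ∀ (V : X.Opens) (h : V ≤ U), Function.Bijective fun r : Γ(X, V) => r • resMap L h e

variable {L}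

theorem resMap_resMap {U V W : X.Opens} (h : V ≤ U) (h' : W ≤ V) (m : Γ(L, U)) :
    resMap L h' (resMap L h m) = resMap L (h'.trans h) m := by
  change (L.presheaf.map (homOfLE h).op ≫ L.presheaf.map (homOfLE h').op) m = _
  rw [← L.presheaf.map_comp]
  rfl

theorem resMap_refl {U : X.Opens} (m : Γ(L, U)) : resMap L le_rfl m = m := by
  change L.presheaf.map (𝟙 _) m = m
  rw [L.presheaf.map_id]
  rfl

theorem germMap_resMap {U V : X.Opens} (h : V ≤ U) (x : X) (hx : x ∈ V) (m : Γ(L, U)) :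
    germMap L V x hx (resMap L h m) = germMap L U x (h hx) m :=
  TopCat.Presheaf.germ_res_apply L.presheaf (homOfLE h) x hx m

theorem IsTrivialization.res {U V : X.Opens} {e : Γ(L, U)} (he : IsTrivialization L U e)
    (h : V ≤ U) : IsTrivialization L V (resMap L h e) := fun W hW => by
  simpa only [resMap_resMap] using he W (hW.trans h)

theorem IsTrivialization.exists_smul_eq {U : X.Opens} {e : Γ(L, U)} (he : IsTrivialization L U e)
    (m : Γ(L, U)) : ∃ r : Γ(X, U), r • e = m := by
  simpa only [resMap_refl] using (he U le_rfl).2 m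

/-- Elements of the stalk, and relations between them, come from smaller neighbourhoods, and `r ↦ r
• e` is bijective on each of these. -/
theorem IsTrivialization.bijective_smul_germ {U : X.Opens} {e : Γ(L, U)}
    (he : IsTrivialization L U e) (x : X) (hx : x ∈ U) :
    Function.Bijective (LinearMap.toSpanSingleton (X.presheaf.stalk x) (L.presheaf.stalk x)
      (germMap L U x hx e)) := by
  constructor
  · rw [injective_iff_map_eq_zero]
    intro r hr
    obtain ⟨V, hVU, hxV, r, rfl⟩ := X.presheaf.exists_le_germ_eq r hx
    rw [LinearMap.toSpanSingleton_apply, ← germMap_resMap hVU x hxV] at hr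
    have h1 : germMap L V x hxV (r • resMap L hVU e) = germMap L V x hxV 0 := by
      rw [LinearMap.map_smulₛₗ, map_zero]
      exact hr
    obtain ⟨W, hxW, i, j, hW⟩ := TopCat.Presheaf.germ_eq L.presheaf x hxV hxV _ _ h1
    have h2 : X.presheaf.map i.op r • resMap L (i.le.trans hVU) e = 0 := by
      rw [← resMap_resMap hVU i.le]
      have h3 := LinearMap.map_smulₛₗ (resMap L i.le) r (resMap L hVU e)
      exact h3.symm.trans (hW.trans (map_zero (resMap L j.le)))
    have h3 : X.presheaf.map i.op r = 0 :=
      (he W (i.le.trans hVU)).1 (h2.trans (zero_smul _ _).symm)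
    rw [← X.presheaf.germ_res_apply i x hxW r, h3, map_zero]
  · intro m
    obtain ⟨V, hVU, hxV, m, rfl⟩ := TopCat.Presheaf.exists_le_germ_eq L.presheaf m hx
    obtain ⟨r, rfl⟩ := (he.res hVU).exists_smul_eq m
    refine ⟨X.presheaf.germ V x hxV r, ?_⟩
    rw [LinearMap.toSpanSingleton_apply, ← germMap_resMap hVU x hxV]
    exact (LinearMap.map_smulₛₗ (germMap L V x hxV) r _).symm

/-- The coordinate `L_x → 𝒪_x` with respect to a trivialization around `x`. -/
def IsTrivialization.coord {U : X.Opens} {e : Γ(L, U)} (he : IsTrivialization L U e)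
    (x : X) (hx : x ∈ U) : L.presheaf.stalk x →ₗ[X.presheaf.stalk x] X.presheaf.stalk x :=
  (LinearEquiv.ofBijective _ (he.bijective_smul_germ x hx)).symm.toLinearMap

theorem IsTrivialization.coord_smul {U : X.Opens} {e : Γ(L, U)} (he : IsTrivialization L U e)
    (x : X) (hx : x ∈ U) (r : Γ(X, U)) :
    he.coord x hx (germMap L U x hx (r • e)) = X.presheaf.germ U x hx r := by
  rw [IsTrivialization.coord, LinearEquiv.coe_coe, LinearEquiv.symm_apply_eq,
    LinearMap.map_smulₛₗ]
  rfl

/-- The value at `x`, with respect to a trivialization around `x`, of a family of tensor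
germs. -/
def IsTrivialization.value {U : X.Opens} {e : Γ(L, U)} (he : IsTrivialization L U e)
    (x : X) (hx : x ∈ U) : TensorGerms L →+* X.presheaf.stalk x :=
  -- The lift to the tensor algebra multiplies coordinates, so a single ring homomorphism handles
  -- all degrees and turns a product of sections into a product of functions.
  (TensorAlgebra.lift (X.presheaf.stalk x) (he.coord x hx)).toRingHom.comp
    (Pi.evalRingHom (fun x : X => TensorAlgebra (X.presheaf.stalk x) (L.presheaf.stalk x)) x)

theorem IsTrivialization.value_eq_germ {U : X.Opens} {e : Γ(L, U)} (he : IsTrivialization L U e)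
    (x : X) (hx : x ∈ U) {s : TensorGerms L} {r : Γ(X, U)}
    (hs : s x = TensorAlgebra.ι _ (germMap L U x hx (r • e))) :
    he.value x hx s = X.presheaf.germ U x hx r := by
  change TensorAlgebra.lift (X.presheaf.stalk x) (he.coord x hx) (s x) = _
  rw [hs, TensorAlgebra.lift_ι_apply, he.coord_smul]

theorem IsTrivialization.value_of_eq_zero {U : X.Opens} {e : Γ(L, U)}
    (he : IsTrivialization L U e) (x : X) (hx : x ∈ U) {s : TensorGerms L} (hs : s x = 0) :
    he.value x hx s = 0 := by
  change TensorAlgebra.lift (X.presheaf.stalk x) (he.coord x hx) (s x) = _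
  rw [hs, map_zero]

theorem IsTrivialization.value_algebraMap [X.Over (Spec (.of ℂ))] {U : X.Opens} {e : Γ(L, U)}
    (he : IsTrivialization L U e) (x : X) (hx : x ∈ U) (c : ℂ) :
    he.value x hx (algebraMap ℂ (TensorGerms L) c) =
      X.presheaf.germ ⊤ x trivial (constMap X c) :=
  AlgHom.commutes (TensorAlgebra.lift (X.presheaf.stalk x) (he.coord x hx)) _

theorem IsLineBundle.exists_affine_trivialization (hL : IsLineBundle L) {W : X.Opens} {x : X}
    (hx : x ∈ W) : ∃ U : X.Opens, x ∈ U ∧ U ≤ W ∧ IsAffineOpen U ∧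
      ∃ e : Γ(L, U), IsTrivialization L U e := by
  obtain ⟨V, hxV, e, he⟩ := hL x
  obtain ⟨U, hU, hxU, hUV⟩ := exists_isAffineOpen_mem_and_subset (U := V ⊓ W) ⟨hxV, hx⟩
  exact ⟨U, hxU, hUV.trans inf_le_right, hU, _, IsTrivialization.res he (hUV.trans inf_le_left)⟩

variable [X.Over (Spec (.of ℂ))]

/-- A section of `L^{⊗ 1}` is locally a section of `L`. -/
theorem exists_ι_germMap_eq {s : TensorGerms L} (hs : s ∈ tensorPowSections L 1) (x : X) :
    ∃ U : X.Opens, x ∈ U ∧ ∃ m : Γ(L, U), ∀ (y : X) (hy : y ∈ U),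
      s y = TensorAlgebra.ι _ (germMap L U y hy m) := by
  obtain ⟨U, hxU, p, hp, h⟩ := hs x
  rw [tensorPow, pow_one] at hp
  obtain ⟨m, rfl⟩ := hp
  exact ⟨U, hxU, m, fun y hy => (h y hy).trans (tensorAlgebraMap_ι _ _)⟩

/-- On an integral scheme, a section of a line bundle which vanishes at the generic point is
zero. -/
theorem IsLineBundle.eq_zero_of_genericPoint [IsIntegral X] (hL : IsLineBundle L)
    {s : TensorGerms L} (hs : s ∈ tensorPowSections L 1) (h0 : s (genericPoint X) = 0) :
    s = 0 := by
  funext x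
  obtain ⟨W, hxW, m, hm⟩ := exists_ι_germMap_eq hs x
  obtain ⟨U, hxU, hUW, -, e, he⟩ := hL.exists_affine_trivialization hxW
  have hη : genericPoint X ∈ U :=
    ((genericPoint_spec X).mem_open_set_iff U.isOpen).2 ⟨x, trivial, hxU⟩
  obtain ⟨r, hr⟩ := he.exists_smul_eq (resMap L hUW m)
  have h1 := he.value_of_eq_zero _ hη h0
  rw [he.value_eq_germ _ hη (r := r) (by rw [hr, germMap_resMap, hm _ (hUW hη)])] at h1
  have h2 : r = 0 := germ_injective_of_isIntegral X _ hη (h1.trans (map_zero _).symm)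
  rw [hm x (hUW hxU), ← germMap_resMap hUW x hxU, ← hr, h2, zero_smul, map_zero, map_zero]
  rfl

/-- In degree one the value at the generic point is the image of the germ under the isomorphism `L_x
≃ 𝒪_x`, so nothing is lost. -/
theorem IsLineBundle.eq_zero_of_value_eq_zero [IsIntegral X] (hL : IsLineBundle L)
    {s : TensorGerms L} (hs : s ∈ tensorPowSections L 1) {U : X.Opens} {e : Γ(L, U)}
    (he : IsTrivialization L U e) (hU : genericPoint X ∈ U)
    (h0 : he.value (genericPoint X) hU s = 0) : s = 0 := by
  refine hL.eq_zero_of_genericPoint hs ?_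
  obtain ⟨W, hxW, m, hm⟩ := exists_ι_germMap_eq hs (genericPoint X)
  have h1 : he.coord _ hU (germMap L W _ hxW m) = 0 := by
    rw [← h0, ← TensorAlgebra.lift_ι_apply (he.coord _ hU), ← hm _ hxW]
    rfl
  rw [hm _ hxW, (LinearEquiv.map_eq_zero_iff _).1 h1, map_zero]

/-- Around every point, two sections of a line bundle are given by regular functions on a common
affine trivializing open set. -/
theorem IsLineBundle.exists_affine_value_eq_germ (hL : IsLineBundle L) {s t : TensorGerms L}
    (hs : s ∈ tensorPowSections L 1) (ht : t ∈ tensorPowSections L 1) (x : X) :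
    ∃ (U : X.Opens) (_ : x ∈ U) (_ : IsAffineOpen U) (e : Γ(L, U)) (he : IsTrivialization L U e)
      (a b : Γ(X, U)), ∀ (y : X) (hy : y ∈ U), he.value y hy s = X.presheaf.germ U y hy a ∧
        he.value y hy t = X.presheaf.germ U y hy b := by
  obtain ⟨V, hxV, m, hm⟩ := exists_ι_germMap_eq hs x
  obtain ⟨W, hxW, n, hn⟩ := exists_ι_germMap_eq ht x
  obtain ⟨U, hxU, hUVW, hU, e, he⟩ :=
    hL.exists_affine_trivialization (W := V ⊓ W) ⟨hxV, hxW⟩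
  have hUV : U ≤ V := hUVW.trans inf_le_left
  have hUW : U ≤ W := hUVW.trans inf_le_right
  obtain ⟨a, ha⟩ := he.exists_smul_eq (resMap L hUV m)
  obtain ⟨b, hb⟩ := he.exists_smul_eq (resMap L hUW n)
  refine ⟨U, hxU, hU, e, he, a, b, fun y hy => ⟨he.value_eq_germ _ _ ?_, he.value_eq_germ _ _ ?_⟩⟩
  · rw [ha, germMap_resMap, hm _ (hUV hy)]
  · rw [hb, germMap_resMap, hn _ (hUW hy)]

variable (X) in
/-- The constants, as functions on the open set `U`. -/
def constMapOn (U : X.Opens) : ℂ →+* Γ(X, U) :=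
  (X.presheaf.map (homOfLE le_top).op).hom.comp (constMap X)

theorem germ_constMapOn (U : X.Opens) (x : X) (hx : x ∈ U) (c : ℂ) :
    X.presheaf.germ U x hx (constMapOn X U c) = X.presheaf.germ ⊤ x trivial (constMap X c) :=
  X.presheaf.germ_res_apply (homOfLE le_top) x hx (constMap X c)

theorem constMapOn_finiteType [LocallyOfFiniteType (X ↘ Spec (.of ℂ))] {U : X.Opens}
    (hU : IsAffineOpen U) : (constMapOn X U).FiniteType := by
  have h1 := (X ↘ Spec (.of ℂ)).finiteType_appLE (isAffineOpen_top _) hU le_top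
  have h2 : (Scheme.ΓSpecIso (.of ℂ)).inv.hom.FiniteType :=
    .of_surjective _ (ConcreteCategory.bijective_of_isIso (Scheme.ΓSpecIso (.of ℂ)).inv).2
  exact h1.comp h2

/-- Let `s` and `t` be sections of a line bundle on a complex variety, with `s ≠ 0` and `t` not a
multiple of `s`. Then for only finitely many `c`, the section `s + c t` divides a power of `s`. -/
theorem IsLineBundle.finite_mul_add_smul_eq_pow (hX : IsComplexVariety X) (hL : IsLineBundle L)
    {s t : TensorGerms L} (hs : s ∈ tensorPowSections L 1) (ht : t ∈ tensorPowSections L 1)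
    (hs0 : s ≠ 0) (hst : ∀ c : ℂ, t ≠ c • s) :
    {c : ℂ | ∃ (u : TensorGerms L) (k : ℕ), u * (s + c • t) = s ^ k}.Finite := by
  have := hX.isIntegral
  have := hX.locallyOfFiniteType
  obtain ⟨U, hηU, hU, e, he, a, b, hab⟩ := hL.exists_affine_value_eq_germ hs ht (genericPoint X)
  have : Nonempty U := ⟨⟨_, hηU⟩⟩
  let _ : Algebra ℂ Γ(X, U) := (constMapOn X U).toAlgebra
  have : Algebra.FiniteType ℂ Γ(X, U) := constMapOn_finiteType hU
  have hsmul : ∀ (c : ℂ) (x : X) (hx : x ∈ U) (v : TensorGerms L) (r : Γ(X, U)),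
      he.value x hx v = X.presheaf.germ U x hx r →
      he.value x hx (c • v) = X.presheaf.germ U x hx (c • r) := fun c x hx v r h => by
    rw [Algebra.smul_def, Algebra.smul_def, map_mul, map_mul, he.value_algebraMap, h,
      ← germ_constMapOn U x hx]
    rfl
  have ha : a ≠ 0 := fun ha => hs0 <| hL.eq_zero_of_value_eq_zero hs he hηU <| by
    rw [(hab _ hηU).1, ha, map_zero]
  have hb : ∀ c : ℂ, b ≠ c • a := fun c hb => hst c <| sub_eq_zero.1 <|
    hL.eq_zero_of_value_eq_zero (sub_mem ht (Submodule.smul_mem _ c hs)) he hηU <| by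
      rw [map_sub, hsmul c _ hηU s a (hab _ hηU).1, (hab _ hηU).2, hb, sub_self]
  refine (finite_forall_add_smul_mem_imp_mem ha hb).subset ?_
  -- At a point `q` with `a ∉ q`, the value of `s ^ k` is a unit of the local ring, hence so is that
  -- of its factor `s + c t`, and `a + c b` cannot lie in `q`.
  rintro c ⟨u, k, h⟩ q hq
  by_contra haq
  have hx : hU.fromSpec q ∈ U := by
    have : hU.fromSpec q ∈ Set.range hU.fromSpec := ⟨q, rfl⟩
    rwa [hU.range_fromSpec] at this
  have hmem : ∀ r : Γ(X, U), IsUnit (X.presheaf.germ U _ hx r) ↔ r ∉ q.asIdeal := fun r => by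
    rw [← X.mem_basicOpen r _ hx]
    have := hU.fromSpec_preimage_basicOpen r
    exact (SetLike.ext_iff.1 this q)
  have h1 := congrArg (he.value _ hx) h
  rw [map_mul, map_add, map_pow, (hab _ hx).1, hsmul c _ hx t b (hab _ hx).2, ← map_add] at h1
  have h2 : IsUnit (X.presheaf.germ U _ hx (a + c • b)) :=
    isUnit_of_mul_isUnit_right (h1 ▸ ((hmem a).2 haq).pow k)
  exact (hmem _).1 h2 hq

end Trivializations

/-! ### The example is approximable -/

section Approximable

/-- A direct sum of subspaces of a domain, graded by `ℕ`, is a domain. -/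
theorem isDomain_directSum {R K : Type*} [CommRing R] [CommRing K] [IsDomain K] [Algebra R K]
    (B : ℕ → Submodule R K) [SetLike.GradedMonoid B] : IsDomain (⨁ n, B n) := by
  -- Tagging degree `n` by `X ^ n` embeds the direct sum in the domain `K[X]`; the coefficients
  -- recover the components.
  let Φ : (⨁ n, B n) →+* K[X] := DirectSum.toSemiring
    (fun n => (Polynomial.monomial n).toAddMonoidHom.comp (B n).subtype.toAddMonoidHom)
    rfl (fun a b => by simp [Polynomial.monomial_mul_monomial])
  have hΦ : ∀ x n, (Φ x).coeff n = x n := fun x n => by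
    induction x using DirectSum.induction_on with
    | zero => simp
    | of i b =>
      have : Φ (DirectSum.of (fun n => B n) i b) = Polynomial.monomial i (b : K) :=
        DirectSum.toSemiring_of _ _ _ _ _
      rw [this, Polynomial.coeff_monomial]
      split_ifs with h
      · subst h
        simp
      · rw [DirectSum.of_eq_of_ne _ _ _ (Ne.symm h)]
        simp
    | add x y hx hy => simp [hx, hy]
  refine Function.Injective.isDomain Φ fun x y h => ?_
  ext n
  rw [← hΦ, ← hΦ, h]

/-! ### Dimensions of `B_n` and of the image of `Sym^n B_p`. -/

variable (z : ℕ → ℂ)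

theorem mem_degreeLT_succ {Q : ℂ[X]} {d : ℕ} :
    Q ∈ Polynomial.degreeLT ℂ (d + 1) ↔ Q.natDegree ≤ d := by
  rw [Polynomial.mem_degreeLT]
  by_cases hQ : Q = 0
  · simp [hQ]
  · rw [← Polynomial.natDegree_lt_iff_degree_lt hQ, Nat.lt_succ_iff]

/-- The map `Q ↦ Q / P` on the polynomials `Q` of degree less than `d`. -/
noncomputable def divMap (d : ℕ) (P : ℂ[X]) : Polynomial.degreeLT ℂ d →ₗ[ℂ] RatFunc ℂ :=
  (LinearMap.mulRight ℂ (algebraMap ℂ[X] (RatFunc ℂ) P)⁻¹ ∘ₗ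
    (IsScalarTower.toAlgHom ℂ ℂ[X] (RatFunc ℂ)).toLinearMap) ∘ₗ (Polynomial.degreeLT ℂ d).subtype

theorem divMap_apply (d : ℕ) (P : ℂ[X]) (Q : Polynomial.degreeLT ℂ d) :
    divMap d P Q = algebraMap ℂ[X] (RatFunc ℂ) Q / algebraMap ℂ[X] (RatFunc ℂ) P := by
  simp [divMap, div_eq_mul_inv]

theorem divMap_injective (d : ℕ) {P : ℂ[X]} (hP : P ≠ 0) :
    Function.Injective (divMap d P) := fun Q Q' h => by
  have hP' : algebraMap ℂ[X] (RatFunc ℂ) P ≠ 0 := by simpa using hP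
  rw [divMap_apply, divMap_apply, div_left_inj' hP'] at h
  exact Subtype.ext (RatFunc.algebraMap_injective ℂ h)

theorem finrank_range_divMap (d : ℕ) {P : ℂ[X]} (hP : P ≠ 0) :
    Module.finrank ℂ (LinearMap.range (divMap d P)) = d := by
  rw [LinearMap.finrank_range_of_inj (divMap_injective d hP),
    (Polynomial.degreeLTEquiv ℂ d).finrank_eq, Module.finrank_fin_fun]

theorem range_divMap (n : ℕ) :
    LinearMap.range (divMap (exampleJ n + 1) (exampleP z n)) = exampleB z n := by
  ext f
  constructor
  · rintro ⟨⟨Q, hQ⟩, rfl⟩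
    exact ⟨Q, mem_degreeLT_succ.1 hQ, divMap_apply _ _ _⟩
  · rintro ⟨Q, hQ, rfl⟩
    exact ⟨⟨Q, mem_degreeLT_succ.2 hQ⟩, divMap_apply _ _ _⟩

instance finiteDimensional_exampleB (n : ℕ) : FiniteDimensional ℂ (exampleB z n) := by
  have : FiniteDimensional ℂ (Polynomial.degreeLT ℂ (exampleJ n + 1)) :=
    (Polynomial.degreeLTEquiv ℂ (exampleJ n + 1)).symm.finiteDimensional
  rw [← range_divMap]
  infer_instance

theorem finrank_exampleB (n : ℕ) : Module.finrank ℂ (exampleB z n) = exampleJ n + 1 := by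
  rw [← range_divMap, finrank_range_divMap _ (exampleP_monic z n).ne_zero]

/-- `Q / P_p^n` is a combination of products of `n` elements of `B_p` whenever
`deg Q ≤ n J(p)`. -/
theorem range_divMap_le_pow (n p : ℕ) :
    LinearMap.range (divMap (n * exampleJ p + 1) (exampleP z p ^ n)) ≤ exampleB z p ^ n := by
  have key : ∀ n k, k ≤ n * exampleJ p →
      algebraMap ℂ[X] (RatFunc ℂ) (Polynomial.X ^ k) /
        algebraMap ℂ[X] (RatFunc ℂ) (exampleP z p ^ n) ∈ exampleB z p ^ n := by
    intro n
    induction n with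
    | zero =>
      intro k hk
      obtain rfl : k = 0 := by omega
      simpa using Submodule.one_le.mp (le_refl (1 : Submodule ℂ (RatFunc ℂ)))
    | succ n ih =>
      intro k hk
      -- The exponent is split as `k = (k - J(p)) + min k J(p)`, with truncated subtraction: one
      -- factor absorbs as much as it can, the other `n` take the rest.
      have hk1 : k - exampleJ p ≤ n * exampleJ p := by
        rw [Nat.succ_mul] at hk; omega
      have h1 := ih _ hk1
      have h2 : algebraMap ℂ[X] (RatFunc ℂ) (Polynomial.X ^ (min k (exampleJ p))) /
          algebraMap ℂ[X] (RatFunc ℂ) (exampleP z p) ∈ exampleB z p :=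
        ⟨_, by simp, rfl⟩
      have h3 := Submodule.mul_mem_mul h1 h2
      rw [div_mul_div_comm, ← map_mul, ← map_mul, ← pow_add, ← pow_succ,
        show k - exampleJ p + min k (exampleJ p) = k by omega, ← pow_succ] at h3
      exact h3
  rintro _ ⟨⟨Q, hQ⟩, rfl⟩
  rw [divMap_apply]
  change algebraMap ℂ[X] (RatFunc ℂ) Q / _ ∈ _
  have hQ' := mem_degreeLT_succ.1 hQ
  rw [Q.as_sum_range_C_mul_X_pow, map_sum, Finset.sum_div]
  refine Submodule.sum_mem _ fun i hi => ?_
  have h := Submodule.smul_mem _ (Q.coeff i) (key n i (by simp at hi; omega))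
  rwa [Algebra.smul_def, ← mul_div_assoc, IsScalarTower.algebraMap_apply ℂ ℂ[X] (RatFunc ℂ),
    ← map_mul] at h

theorem symImage_le_range_lof (n p : ℕ) :
    symImage (fun n => exampleB z n) n p ≤
      LinearMap.range (DirectSum.lof ℂ ℕ (fun n => exampleB z n) (n * p)) := by
  induction n with
  | zero =>
    rw [symImage, pow_zero, Submodule.one_le]
    rw [zero_mul]
    exact ⟨1, rfl⟩
  | succ n ih =>
    rw [symImage, pow_succ, Submodule.mul_le]
    intro x hx y hy
    obtain ⟨x, rfl⟩ := ih hx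
    obtain ⟨y, rfl⟩ := hy
    rw [Nat.succ_mul]
    exact ⟨GradedMonoid.GMul.mul (A := fun n => exampleB z n) x y,
      (DirectSum.of_mul_of (A := fun n => exampleB z n) x y).symm⟩

instance finiteDimensional_symImage (n p : ℕ) :
    FiniteDimensional ℂ (symImage (fun n => exampleB z n) n p) :=
  Submodule.finiteDimensional_of_le (symImage_le_range_lof z n p)

theorem finrank_symImage_le (n p : ℕ) :
    Module.finrank ℂ (symImage (fun n => exampleB z n) n p) ≤
      Module.finrank ℂ (exampleB z (n * p)) :=
  (Submodule.finrank_mono (symImage_le_range_lof z n p)).trans (LinearMap.finrank_range_le _)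

/-- Forgetting the grading maps the image of `Sym^n B_p` onto the power `B_p ^ n` inside `ℂ(x)`, and
a linear map does not raise dimension. -/
theorem le_finrank_symImage (n p : ℕ) :
    n * exampleJ p + 1 ≤ Module.finrank ℂ (symImage (fun n => exampleB z n) n p) := by
  let Φ : (⨁ n, exampleB z n) →ₐ[ℂ] RatFunc ℂ := DirectSum.coeAlgHom (exampleB z)
  have hmap : (symImage (fun n => exampleB z n) n p).map Φ.toLinearMap = exampleB z p ^ n := by
    rw [symImage, Submodule.map_pow, ← LinearMap.range_comp]
    congr 1
    have : Φ.toLinearMap ∘ₗ DirectSum.lof ℂ ℕ (fun n => exampleB z n) p =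
        (exampleB z p).subtype := by
      ext x
      simp [Φ, DirectSum.lof_eq_of]
    rw [this, Submodule.range_subtype]
  have hfin : FiniteDimensional ℂ ↥(exampleB z p ^ n) := by
    rw [← hmap]
    infer_instance
  calc n * exampleJ p + 1
      = Module.finrank ℂ (LinearMap.range
          (divMap (n * exampleJ p + 1) (exampleP z p ^ n))) :=
        (finrank_range_divMap _ (pow_ne_zero _ (exampleP_monic z p).ne_zero)).symm
    _ ≤ Module.finrank ℂ ↥(exampleB z p ^ n) :=
        Submodule.finrank_mono (range_divMap_le_pow z n p)
    _ ≤ _ := by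
        rw [← hmap]
        exact Submodule.finrank_map_le _ _

/-- By induction the first `k` terms plus twice the next one are at most `2n`. Stopping at the last
nonzero term, `i = log₂ n`, makes the inequality strict; this absorbs the `+ 1` in `dim B_n`. -/
theorem exampleJ_lt {n : ℕ} (hn : 0 < n) : exampleJ n < 2 * n := by
  have h : ∀ k, (∑ i ∈ Finset.range k, n / 2 ^ i) + n / 2 ^ k * 2 ≤ 2 * n := by
    intro k
    induction k with
    | zero => simp [mul_comm]
    | succ k ih =>
      rw [Finset.sum_range_succ, pow_succ, ← Nat.div_div_eq_div_mul]
      omega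
  have h1 : ∀ k, n / 2 ^ k ≠ 0 → (∑ i ∈ Finset.range (k + 1), n / 2 ^ i) < 2 * n := fun k hk => by
    have := h k
    rw [Finset.sum_range_succ]
    omega
  let m := Nat.log 2 n
  have hm : n / 2 ^ m ≠ 0 :=
    (Nat.div_pos (Nat.pow_log_le_self 2 hn.ne') (by positivity)).ne'
  have h2 := h1 m hm
  have hmn : m ≤ n := Nat.log_le_self 2 n
  have : exampleJ n = ∑ i ∈ Finset.range (m + 1), n / 2 ^ i := by
    symm
    refine Finset.sum_subset (Finset.range_subset_range.2 (by omega)) fun i _ hi => ?_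
    have hi' : m < i := by simpa using hi
    exact Nat.div_eq_of_lt (Nat.lt_pow_of_log_lt (by norm_num) hi')
  rwa [this]

/-- Only the first `k` terms are kept, and each floor loses at most `1`. -/
theorem le_exampleJ {n k : ℕ} (hk : k ≤ n) :
    2 * (n : ℝ) * (1 - (1 / 2) ^ k) - k ≤ exampleJ n := by
  have h : ∀ k, 2 * (n : ℝ) * (1 - (1 / 2) ^ k) - k ≤
      ((∑ i ∈ Finset.range k, n / 2 ^ i : ℕ) : ℝ) := by
    intro k
    induction k with
    | zero => simp
    | succ k ih =>
      rw [Finset.sum_range_succ, Nat.cast_add]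
      have h1 : (n : ℝ) * (1 / 2) ^ k - 1 ≤ ((n / 2 ^ k : ℕ) : ℝ) := by
        have := (Nat.lt_floor_add_one ((n : ℝ) / ((2 ^ k : ℕ) : ℝ))).le
        rw [Nat.floor_div_eq_div] at this
        rw [one_div, inv_pow, ← div_eq_mul_inv]
        push_cast at this
        linarith
      push_cast at ih h1 ⊢
      rw [pow_succ]
      linarith
  refine (h k).trans ?_
  exact_mod_cast Finset.sum_le_sum_of_subset (Finset.range_subset_range.2 (by omega))

theorem tendsto_exampleJ_div :
    Filter.Tendsto (fun p : ℕ => (exampleJ p : ℝ) / (2 * p)) Filter.atTop (nhds 1) := by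
  rw [Metric.tendsto_atTop]
  intro ε hε
  -- The defect of `J(p) / (2p)` from `1` is at most `2^{-k} + k / (2p)`; each term is below `ε / 2`
  -- once `k` is chosen and `p > k / ε`.
  obtain ⟨k, hk⟩ := exists_pow_lt_of_lt_one (half_pos hε) (show (1 / 2 : ℝ) < 1 by norm_num)
  obtain ⟨N, hN⟩ := exists_nat_gt ((k : ℝ) / ε)
  refine ⟨max (max k N) 1, fun p hp => ?_⟩
  have hp1 : 0 < p := by omega
  have hp0 : (0 : ℝ) < 2 * p := by positivity
  have h1 := le_exampleJ (show k ≤ p by omega)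
  have h2 : (exampleJ p : ℝ) < 2 * p := by exact_mod_cast exampleJ_lt hp1
  have h3 : (k : ℝ) < ε * p := by
    have : (N : ℝ) ≤ p := by exact_mod_cast (show N ≤ p by omega)
    rw [div_lt_iff₀ hε] at hN
    nlinarith
  rw [Real.dist_eq, abs_sub_comm, abs_of_nonneg (by rw [sub_nonneg, div_le_one hp0]; exact h2.le),
    sub_lt_comm, lt_div_iff₀ hp0]
  have hp2 : (0 : ℝ) < p := by positivity
  nlinarith

theorem isApproximable_exampleB : IsApproximable (fun n => exampleB z n) where
  isDomain := isDomain_directSum (exampleB z)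
  finiteDimensional n := finiteDimensional_exampleB z n
  eventually_nontrivial := .of_forall fun n => by
    have : 0 < Module.finrank ℂ (exampleB z n) := by
      rw [finrank_exampleB]
      exact Nat.succ_pos _
    exact Module.nontrivial_of_finrank_pos this
  approx ε hε := by
    obtain ⟨p₀, hp₀⟩ := Filter.eventually_atTop.1
      (tendsto_exampleJ_div.eventually (lt_mem_nhds (show 1 - ε < 1 by linarith)))
    refine ⟨max p₀ 1, fun p hp => (hp₀ p (by omega)).trans_le ?_⟩
    have hp1 : 0 < p := by omega
    -- In `ℝ` a lower bound for a `liminf` requires some bound from above; the quotients are at most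
    -- `1`.
    refine Filter.le_liminf_of_le (Filter.IsCoboundedUnder.of_frequently_le (a := 1)
      (.of_forall fun n => ?_)) ?_
    · refine div_le_one_of_le₀ ?_ (Nat.cast_nonneg _)
      exact_mod_cast finrank_symImage_le z n p
    · filter_upwards [Filter.eventually_gt_atTop 0] with n hn
      have h1 : ((n * exampleJ p + 1 : ℕ) : ℝ) ≤
          Module.finrank ℂ (symImage (fun n => exampleB z n) n p) := by
        exact_mod_cast le_finrank_symImage z n p
      have h2 : (Module.finrank ℂ (exampleB z (n * p)) : ℝ) ≤ n * (2 * p) := by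
        rw [finrank_exampleB]
        have := exampleJ_lt (Nat.mul_pos hn hp1)
        have h3 : exampleJ (n * p) + 1 ≤ n * (2 * p) := by
          rw [Nat.mul_left_comm]; omega
        exact_mod_cast h3
      have h3 : (0 : ℝ) < Module.finrank ℂ (exampleB z (n * p)) := by
        rw [finrank_exampleB]; positivity
      have hn0 : (n : ℝ) ≠ 0 := by positivity
      -- Written as `n J(p) / (n · 2p)`, the bound can be compared by numerators and denominators.
      rw [← mul_div_mul_left _ _ hn0]
      refine div_le_div₀ (Nat.cast_nonneg _) (le_trans ?_ h1) h3 h2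
      push_cast
      linarith

end Approximable

/-! ### The example is non-sectional -/

section NonSectional

variable (z : ℕ → ℂ)

theorem one_mem_exampleB (n : ℕ) : (1 : RatFunc ℂ) ∈ exampleB z n :=
  ⟨exampleP z n, (exampleP_natDegree z n).le, by
    rw [div_self (by simpa using (exampleP_monic z n).ne_zero)]⟩

theorem inv_mem_exampleB_one :
    (algebraMap ℂ[X] (RatFunc ℂ) (Polynomial.X - Polynomial.C (z 0)))⁻¹ ∈ exampleB z 1 :=
  ⟨1, by simp, by simp [exampleP, Finset.prod_range_succ]⟩

/-- The factor `x - zᵢ` enters `P_n` as soon as `n ≥ 2 ^ i`. Replacing it by `x - z₀` in the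
numerator keeps the degree equal to `J(2 ^ i)`. -/
theorem div_mem_exampleB_two_pow (i : ℕ) :
    algebraMap ℂ[X] (RatFunc ℂ) (Polynomial.X - Polynomial.C (z 0)) /
      algebraMap ℂ[X] (RatFunc ℂ) (Polynomial.X - Polynomial.C (z i)) ∈ exampleB z (2 ^ i) := by
  have hdvd : Polynomial.X - Polynomial.C (z i) ∣ exampleP z (2 ^ i) := by
    refine Dvd.dvd.trans ?_ (Finset.dvd_prod_of_mem _
      (Finset.mem_range.2 (Nat.lt_succ_of_lt (Nat.lt_two_pow_self (n := i)))))
    simp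
  obtain ⟨D, hD⟩ := hdvd
  have hD0 : D ≠ 0 := by
    rintro rfl
    exact (exampleP_monic z (2 ^ i)).ne_zero (hD.trans (mul_zero _))
  refine ⟨(Polynomial.X - Polynomial.C (z 0)) * D, ?_, ?_⟩
  · rw [← exampleP_natDegree z, hD, Polynomial.natDegree_mul (Polynomial.X_sub_C_ne_zero _) hD0,
      Polynomial.natDegree_mul (Polynomial.X_sub_C_ne_zero _) hD0, Polynomial.natDegree_X_sub_C,
      Polynomial.natDegree_X_sub_C]
  · rw [hD, map_mul, map_mul, mul_div_mul_right _ _ (by simpa using hD0)]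

theorem of_one_pow (k : ℕ) :
    (DirectSum.of (fun n => exampleB z n) 1 ⟨1, one_mem_exampleB z 1⟩) ^ k =
      DirectSum.of (fun n => exampleB z n) k ⟨1, one_mem_exampleB z k⟩ := by
  rw [DirectSum.ofPow]
  refine DirectSum.of_eq_of_gradedMonoid_eq (Sigma.subtype_ext (mul_one k) ?_)
  exact one_pow k

theorem smul_of_exampleB (n : ℕ) (c : ℂ) (b : exampleB z n) :
    c • DirectSum.of (fun n => exampleB z n) n b =
      DirectSum.of (fun n => exampleB z n) n (c • b) :=
  ((DirectSum.lof ℂ ℕ (fun n => exampleB z n) n).map_smul c b).symm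

/-- In `B`, the element `1 + (z₀ - zᵢ) / (x - z₀)` of degree `1` divides a power of the element
`1` of degree `1`. -/
theorem of_mul_add_smul_eq_pow (i : ℕ) :
    DirectSum.of (fun n => exampleB z n) (2 ^ i) ⟨_, div_mem_exampleB_two_pow z i⟩ *
      (DirectSum.of (fun n => exampleB z n) 1 ⟨1, one_mem_exampleB z 1⟩ +
        (z 0 - z i) • DirectSum.of (fun n => exampleB z n) 1 ⟨_, inv_mem_exampleB_one z⟩) =
      (DirectSum.of (fun n => exampleB z n) 1 ⟨1, one_mem_exampleB z 1⟩) ^ (2 ^ i + 1) := by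
  have hne : ∀ j, algebraMap ℂ[X] (RatFunc ℂ) (Polynomial.X - Polynomial.C (z j)) ≠ 0 := fun j =>
    RatFunc.algebraMap_ne_zero (Polynomial.X_sub_C_ne_zero (z j))
  rw [of_one_pow, smul_of_exampleB, ← map_add, DirectSum.of_mul_of]
  congr 1
  ext1
  change _ / _ * (1 + (z 0 - z i) • _⁻¹) = (1 : RatFunc ℂ)
  have h0 := hne 0
  have hi := hne i
  have hsub : algebraMap ℂ (RatFunc ℂ) (z 0 - z i) =
      algebraMap ℂ[X] (RatFunc ℂ) (Polynomial.X - Polynomial.C (z i)) -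
        algebraMap ℂ[X] (RatFunc ℂ) (Polynomial.X - Polynomial.C (z 0)) := by
    rw [← map_sub, IsScalarTower.algebraMap_apply ℂ ℂ[X] (RatFunc ℂ), Polynomial.algebraMap_eq,
      Polynomial.C_sub]
    congr 1
    ring
  rw [Algebra.smul_def, hsub]
  field_simp
  ring

theorem inv_ne_smul_one (c : ℂ) :
    (algebraMap ℂ[X] (RatFunc ℂ) (Polynomial.X - Polynomial.C (z 0)))⁻¹ ≠ c • 1 := by
  have h0 : algebraMap ℂ[X] (RatFunc ℂ) (Polynomial.X - Polynomial.C (z 0)) ≠ 0 :=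
    RatFunc.algebraMap_ne_zero (Polynomial.X_sub_C_ne_zero (z 0))
  intro h
  have h1 : algebraMap ℂ[X] (RatFunc ℂ) (Polynomial.C c * (Polynomial.X - Polynomial.C (z 0))) =
      algebraMap ℂ[X] (RatFunc ℂ) 1 := by
    rw [map_mul, map_one, show algebraMap ℂ[X] (RatFunc ℂ) (Polynomial.C c) =
      algebraMap ℂ (RatFunc ℂ) c from (IsScalarTower.algebraMap_apply ℂ ℂ[X] (RatFunc ℂ) c).symm,
      ← mul_one (algebraMap ℂ (RatFunc ℂ) c), ← Algebra.smul_def, ← h, inv_mul_cancel₀ h0]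
  -- At `x = z₀` the identity `c (x - z₀) = 1` becomes `0 = 1`.
  have h2 := congrArg (Polynomial.eval (z 0)) (RatFunc.algebraMap_injective ℂ h1)
  simp at h2

theorem isNonSectional_exampleB (hz : Function.Injective z) :
    IsNonSectional (fun n => exampleB z n) := by
  rintro X _ hX L hL - ⟨f, hf, hfB⟩
  -- In `TensorGerms L` all degrees live in one ring. Injectivity is needed only on each graded
  -- piece, where it follows from that of `f`.
  let F : (⨁ n, exampleB z n) →ₐ[ℂ] TensorGerms L :=
    (DirectSum.coeAlgHom (tensorPowSections L)).comp f
  have hF : ∀ n (b : exampleB z n),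
      F (DirectSum.of (fun n => exampleB z n) n b) ∈ tensorPowSections L n ∧
      (F (DirectSum.of (fun n => exampleB z n) n b) = 0 → b = 0) := fun n b => by
    obtain ⟨s, hs⟩ := hfB n b
    have h1 : F (DirectSum.of (fun n => exampleB z n) n b) = s := by
      change DirectSum.coeAlgHom (tensorPowSections L) (f _) = _
      rw [hs, DirectSum.coeAlgHom_of]
    refine ⟨h1 ▸ s.2, fun h0 => ?_⟩
    have hs0 : s = 0 := Subtype.ext (h1.symm.trans h0)
    rw [hs0, map_zero] at hs
    exact DirectSum.of_injective n ((hf (hs.trans (map_zero f).symm)).trans (map_zero _).symm)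
  have hfin := hL.finite_mul_add_smul_eq_pow hX
    (hF 1 ⟨1, one_mem_exampleB z 1⟩).1 (hF 1 ⟨_, inv_mem_exampleB_one z⟩).1
    (fun h => one_ne_zero (congrArg Subtype.val ((hF 1 _).2 h)))
    (fun c h => by
      rw [← map_smul, ← sub_eq_zero, ← map_sub, smul_of_exampleB, ← map_sub] at h
      exact inv_ne_smul_one z c (sub_eq_zero.1 (congrArg Subtype.val ((hF 1 _).2 h))))
  -- The scalars `z₀ - zᵢ` are pairwise distinct, and all of them lie in the finite set `hfin`.
  refine Set.infinite_range_of_injective (f := fun i => z 0 - z i)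
    (fun i j h => hz (by simpa using h)) (hfin.subset ?_)
  rintro _ ⟨i, rfl⟩
  refine ⟨F (DirectSum.of (fun n => exampleB z n) (2 ^ i) ⟨_, div_mem_exampleB_two_pow z i⟩),
    2 ^ i + 1, ?_⟩
  rw [← map_smul, ← map_add, ← map_mul, of_mul_add_smul_eq_pow, map_pow]

end NonSectional

theorem theorem1p1 :
    (∃ (B : ℕ → Type) (_ : ∀ n, AddCommGroup (B n)) (_ : ∀ n, Module ℂ (B n))
      (_ : DirectSum.GCommRing B) (_ : DirectSum.GAlgebra ℂ B),
      IsApproximable B ∧ IsNonSectional B) ∧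
    ∀ z : ℕ → ℂ, Function.Injective z →
      IsApproximable (fun n => exampleB z n) ∧ IsNonSectional (fun n => exampleB z n) := by
  have h : ∀ z : ℕ → ℂ, Function.Injective z →
      IsApproximable (fun n => exampleB z n) ∧ IsNonSectional (fun n => exampleB z n) :=
    fun z hz => ⟨isApproximable_exampleB z, isNonSectional_exampleB z hz⟩
  exact ⟨⟨fun n => exampleB (fun i => (i : ℂ)) n, inferInstance, inferInstance, inferInstance,
    inferInstance, h _ Nat.cast_injective⟩, h⟩
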